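/- Let $n, m, k$ be integers with $k \ge 1$, $m \ge 1$ and $n \ge 2k-1$. Write $[N] = \{1,\dots,N\}$, and let $\mathcal{H}_{n,m,k}$ be the hypergraph with vertex set $[n+m]$ whose edges are the $k$-element subsets of $[n]$, all pairs $\{i,j\}$ with $i \in [n]$ and $j \in [n+m]\setminus[n]$, and the $k$-element subsets of $[n+m]\setminus[n]$. Then $$\chi(\operatorname{KG}(\mathcal{H}_{n,m,k})) = \operatorname{cd}_2(\mathcal{H}_{n,m,k}) = n+m-2k+2 .$$ Here, for a hypergraph $\mathcal{H}=(V,E)$, $\operatorname{KG}(\mathcal{H})$ is the graph whose vertices are the edges of $\mathcal{H}$, two of them being adjacent when they are disjoint; $\chi$ is the chromatic number; a hypergraph is $2$-colorable if its vertices can be colored with two colors so that no edge is monochromatic (in particular, an edge with a single vertex is always monochromatic); and $$\operatorname{cd}_2(\mathcal{H}) = \min\left\{|U| : U\subseteq V,\ \left(V\setminus U,\ \{e\in E : e\cap U=\varnothing\}\right)\text{ is }2\text{-colorable}\right\}$$ is the $2$-colorability defect of $\mathcal{H}$. -/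

import Mathlib

namespace Hypergraph

/-- The general Kneser graph `KG(H)`: its vertices are the edges of `H`, and two distinct edges of
`H` are adjacent when they are disjoint. (The condition `e ≠ f` follows from disjointness as soon
as the edges are nonempty.) -/
def kneserGraph {α : Type*} (H : Hypergraph α) : SimpleGraph H.edgeSet where
  Adj e f := e ≠ f ∧ Disjoint (e : Set α) (f : Set α)
  symm := ⟨fun _ _ h => ⟨h.1.symm, h.2.symm⟩⟩
  loopless := ⟨fun _ h => h.1 rfl⟩

/-- A hypergraph is 2-colorable if its vertices can be colored with two colors in such a way
that no edge is monochromatic. -/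
def IsTwoColorable {α : Type*} (H : Hypergraph α) : Prop :=
  ∃ c : H.vertexSet → Fin 2, ∀ e ∈ H.edgeSet, ¬ ∃ a : Fin 2, ∀ v : H.vertexSet, v.1 ∈ e → c v = a

/-- The partial hypergraph that remains after removing the vertices in `U`: its edges are the
edges of `H` that do not meet `U`. -/
def removeVertices {α : Type*} (H : Hypergraph α) (U : Set α) : Hypergraph α where
  vertexSet := H.vertexSet \ U
  edgeSet := {e ∈ H.edgeSet | e ∩ U = ∅}
  subset_vertexSet_of_mem_edgeSet' := fun e he x hx =>
    ⟨H.subset_vertexSet_of_mem_edgeSet' he.1 hx, fun hU => by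
      have hmem : x ∈ e ∩ U := ⟨hx, hU⟩
      rw [he.2] at hmem
      exact hmem⟩

/-- The 2-colorability defect `cd₂(H)`: the minimal number of vertices to remove from `H` such
that the remaining partial hypergraph is 2-colorable (it is `⊤` if there is no such
removal, which happens only if the empty set is an edge). -/
noncomputable def colorabilityDefect {α : Type*} (H : Hypergraph α) : ℕ∞ :=
  sInf {d : ℕ∞ | ∃ U : Set α, U ⊆ H.vertexSet ∧ (H.removeVertices U).IsTwoColorable ∧ U.encard = d}

end Hypergraph

/-- The set system `F_{n,m,k}` on `[n+m] = {1, …, n+m}`: the `k`-subsets of `[n]`, the pairs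
`{i, j}` with `i ∈ [n]` and `j ∈ [n+m] ∖ [n]`, and the `k`-subsets of `[n+m] ∖ [n]`. -/
def setSystemF (n m k : ℕ) : Set (Set ℕ) :=
  {e | e ⊆ Set.Icc 1 n ∧ e.encard = k} ∪
  {e | ∃ i ∈ Set.Icc 1 n, ∃ j ∈ Set.Icc 1 (n + m) \ Set.Icc 1 n, e = {i, j}} ∪
  {e | e ⊆ Set.Icc 1 (n + m) \ Set.Icc 1 n ∧ e.encard = k}

/-- The hypergraph `H_{n,m,k}` with vertex set `[n+m]` and edge set `F_{n,m,k}`. -/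
def hypergraphH (n m k : ℕ) : Hypergraph ℕ where
  vertexSet := Set.Icc 1 (n + m)
  edgeSet := setSystemF n m k
  subset_vertexSet_of_mem_edgeSet' := by
    rintro e ((⟨he, -⟩ | ⟨i, hi, j, hj, rfl⟩) | ⟨he, -⟩)
    · exact he.trans (Set.Icc_subset_Icc_right (Nat.le_add_right n m))
    · rintro x (rfl | rfl)
      · exact Set.Icc_subset_Icc_right (Nat.le_add_right n m) hi
      · exact hj.1
    · exact he.trans Set.sdiff_subset

/-! The defect is found by counting. In a 2-colored remainder, a color class lies entirely on one
side of `n`, since a cross pair would be monochromatic, and so has at most `k - 1` elements;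
removing all but `[2k-2]` attains this. Coloring edges by their maxima, with maxima up to `2k - 1`
identified, uses equally many colors.

The remaining bound, Dol'nikov's `colorabilityDefect_le_chromaticNumber`, is topological. A coloring
with `t` colors, `t` less than the defect, would label the nonzero sign vectors on the `N` vertices
by signed elements of an `(N - 1)`-element set, antipodally and with no comparable pair labeled
oppositely. `octahedral_tucker` forbids this.

Tucker's lemma follows from Fan's parity argument. The cochain `F` detecting alternating labels
satisfies `δF = F + F ∘ neg`, so its sum over a sphere equals its sum over the equator, and by
induction is 1 (`sum_flagSum_eq_one`). Hence some full flag has alternating labels, which needs `N`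
distinct indices. -/

/-! ### Mod 2 coboundaries of cochains on lists -/

section Coboundary

variable {β γ : Type*}

/-- The mod 2 simplicial coboundary of a cochain defined on ordered simplices. -/
def coboundary : (List β → ZMod 2) → List β → ZMod 2
  | _, [] => 0
  | f, a :: l => f l + coboundary (fun l' => f (a :: l')) l

theorem coboundary_map (f : List γ → ZMod 2) (g : β → γ) (l : List β) :
    coboundary (fun l' => f (l'.map g)) l = coboundary f (l.map g) := by
  induction l generalizing f with
  | nil => rfl
  | cons a l ih => simpa [coboundary] using ih (fun l' => f (g a :: l'))

theorem coboundary_congr {f g : List β → ZMod 2} {l : List β}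
    (h : ∀ l', l'.Sublist l → f l' = g l') : coboundary f l = coboundary g l := by
  induction l generalizing f g with
  | nil => rfl
  | cons a l ih =>
    simp only [coboundary]
    rw [h l (List.sublist_cons_self a l), ih fun l' hl' => h _ (hl'.cons_cons a)]

theorem coboundary_zero (l : List β) : coboundary (fun _ => 0) l = 0 := by
  induction l with
  | nil => rfl
  | cons a l ih => simpa [coboundary] using ih

theorem coboundary_perm {f : List β → ZMod 2} (hf : ∀ l l', l.Perm l' → f l = f l')
    {l l' : List β} (h : l.Perm l') : coboundary f l = coboundary f l' := by
  induction h generalizing f with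
  | nil => rfl
  | cons a h ih =>
    simp only [coboundary]
    rw [hf _ _ h, ih fun _ _ h => hf _ _ (h.cons a)]
  | swap a b l =>
    simp only [coboundary]
    have : (fun l' => f (b :: a :: l')) = fun l' => f (a :: b :: l') :=
      funext fun l' => hf _ _ (List.Perm.swap a b l')
    rw [this]
    ring
  | trans _ _ ih₁ ih₂ => exact (ih₁ hf).trans (ih₂ hf)

end Coboundary

/-! ### Signed labels and Fan's alternating cochain -/

section Labels

variable {ι : Type*}

/-- The antipodal signed label. -/
def flipSign (p : ι ×ₗ Bool) : ι ×ₗ Bool := toLex ((ofLex p).1, !(ofLex p).2)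

/-- The cochain detecting that the signs of the labels alternate, starting with `s`. -/
def alternating : Bool → List (ι ×ₗ Bool) → ZMod 2
  | _, [] => 1
  | s, a :: l => if (ofLex a).2 = s then alternating (!s) l else 0

/-- If `l` is nonempty and alternates, exactly one end can be deleted to leave an alternating list
starting with `s`. If one adjacent sign repeats, the two possible deletions cancel. -/
theorem coboundary_alternating (s : Bool) (l : List (ι ×ₗ Bool)) :
    coboundary (alternating s) l = alternating s l + alternating (!s) l := by
  induction l generalizing s with
  | nil => exact (CharTwo.add_self_eq_zero (1 : ZMod 2)).symm
  | cons a l ih =>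
    by_cases h : (ofLex a).2 = s
    · have h' : (ofLex a).2 ≠ !s := by simp [h]
      simp only [coboundary, alternating, if_pos h, if_neg h', ih, Bool.not_not]
      rw [add_comm (alternating (!s) l), ← add_assoc, CharTwo.add_self_eq_zero, zero_add, add_zero]
    · have h' : (ofLex a).2 = !s := by revert h; cases (ofLex a).2 <;> cases s <;> simp
      simp only [coboundary, alternating, if_neg h, if_pos h', coboundary_zero, Bool.not_not]
      ring

theorem alternating_map_flipSign (s : Bool) (l : List (ι ×ₗ Bool)) :
    alternating s (l.map flipSign) = alternating (!s) l := by
  induction l generalizing s with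
  | nil => rfl
  | cons a l ih =>
    simp only [List.map_cons, alternating, flipSign, ofLex_toLex, ih]
    congr 1
    cases (ofLex a).2 <;> cases s <;> simp

variable [LinearOrder ι]

theorem fst_lt_of_le_of_snd_ne {a b : ι ×ₗ Bool} (hab : a ≤ b) (hne : b ≠ flipSign a)
    (hs : (ofLex b).2 ≠ (ofLex a).2) : (ofLex a).1 < (ofLex b).1 := by
  rcases Prod.Lex.le_iff.1 hab with h | ⟨h, -⟩
  · exact h
  · refine absurd ?_ hne
    apply ofLex.injective
    refine Prod.ext h.symm ?_
    simp only [flipSign, ofLex_toLex]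
    revert hs
    cases (ofLex a).2 <;> cases (ofLex b).2 <;> simp

/-- Flipping reverses the order only within an antipodal pair, which `hne` excludes. Hence sorting
commutes with flipping in `coboundary_fanCochain`. -/
theorem flipSign_le_flipSign {a b : ι ×ₗ Bool} (hab : a ≤ b) (hne : b ≠ flipSign a) :
    flipSign a ≤ flipSign b := by
  by_cases hs : (ofLex b).2 = (ofLex a).2
  · rcases Prod.Lex.le_iff.1 hab with h | ⟨h, -⟩
    · exact Prod.Lex.le_iff.2 (Or.inl h)
    · exact Prod.Lex.le_iff.2 (Or.inr ⟨h, by simp [flipSign, hs]⟩)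
  · have h := fst_lt_of_le_of_snd_ne hab hne hs
    exact Prod.Lex.le_iff.2 (Or.inl h)

theorem pairwise_fst_lt_of_alternating_ne_zero {s : Bool} {l : List (ι ×ₗ Bool)}
    (hl : l.Pairwise (· ≤ ·)) (hc : ∀ a ∈ l, ∀ b ∈ l, b ≠ flipSign a)
    (h : alternating s l ≠ 0) : l.Pairwise fun a b => (ofLex a).1 < (ofLex b).1 := by
  induction l generalizing s with
  | nil => exact List.Pairwise.nil
  | cons a l ih =>
    have ha : (ofLex a).2 = s := by
      by_contra h'
      exact h (by simp [alternating, h'])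
    have h' : alternating (!s) l ≠ 0 := by simpa [alternating, ha] using h
    rw [List.pairwise_cons] at hl ⊢
    refine ⟨?_, ih hl.2 (fun a ha b hb => hc a (by simp [ha]) b (by simp [hb])) h'⟩
    cases l with
    | nil => simp
    | cons c l =>
      have hcs : (ofLex c).2 = !s := by
        by_contra h''
        exact h' (by simp [alternating, h''])
      have hac : (ofLex a).1 < (ofLex c).1 :=
        fst_lt_of_le_of_snd_ne (hl.1 c (by simp)) (hc a (by simp) c (by simp)) (by simp [ha, hcs])
      intro b hb
      rcases List.mem_cons.1 hb with rfl | hb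
      · exact hac
      · exact hac.trans_le (Prod.Lex.monotone_fst_ofLex (List.rel_of_pairwise_cons hl.2 hb))

theorem length_le_of_alternating_ne_zero [Fintype ι] {s : Bool} {l : List (ι ×ₗ Bool)}
    (hl : l.Pairwise (· ≤ ·)) (hc : ∀ a ∈ l, ∀ b ∈ l, b ≠ flipSign a)
    (h : alternating s l ≠ 0) : l.length ≤ Fintype.card ι := by
  have : (l.map fun a => (ofLex a).1).Nodup := by
    rw [List.nodup_iff_pairwise_ne, List.pairwise_map]
    exact (pairwise_fst_lt_of_alternating_ne_zero hl hc h).imp ne_of_lt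
  simpa using this.length_le_card

/-- Fan's cochain: it detects that the labels, sorted, have alternating signs starting with
`true`. -/
def fanCochain (l : List (ι ×ₗ Bool)) : ZMod 2 := alternating true (l.insertionSort (· ≤ ·))

theorem insertionSort_eq_of_perm {l l' : List (ι ×ₗ Bool)} (hl : l'.Pairwise (· ≤ ·))
    (h : l.Perm l') : l.insertionSort (· ≤ ·) = l' :=
  ((List.perm_insertionSort _ l).trans h).eq_of_pairwise
    (fun _ _ _ _ => le_antisymm) (List.pairwise_insertionSort _ l) hl

theorem fanCochain_perm (l l' : List (ι ×ₗ Bool)) (h : l.Perm l') :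
    fanCochain l = fanCochain l' := by
  unfold fanCochain
  rw [insertionSort_eq_of_perm (List.pairwise_insertionSort _ l')
    (h.trans (List.perm_insertionSort _ l').symm)]

theorem coboundary_fanCochain {l : List (ι ×ₗ Bool)} (hc : ∀ a ∈ l, ∀ b ∈ l, b ≠ flipSign a) :
    coboundary fanCochain l = fanCochain l + fanCochain (l.map flipSign) := by
  have hp := List.perm_insertionSort (· ≤ ·) l
  have hs := List.pairwise_insertionSort (· ≤ ·) l
  rw [← coboundary_perm fanCochain_perm hp, coboundary_congr (g := alternating true),
    coboundary_alternating, ← alternating_map_flipSign]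
  · unfold fanCochain
    rw [insertionSort_eq_of_perm _ (hp.map flipSign).symm]
    rw [List.pairwise_map]
    exact hs.imp_of_mem fun ha hb hab =>
      flipSign_le_flipSign hab (hc _ (hp.mem_iff.1 ha) _ (hp.mem_iff.1 hb))
  · intro l' hl'
    unfold fanCochain
    rw [insertionSort_eq_of_perm (hs.sublist hl') (List.Perm.refl _)]

theorem length_le_of_fanCochain_ne_zero [Fintype ι] {l : List (ι ×ₗ Bool)}
    (hc : ∀ a ∈ l, ∀ b ∈ l, b ≠ flipSign a) (h : fanCochain l ≠ 0) :
    l.length ≤ Fintype.card ι := by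
  have hp := List.perm_insertionSort (· ≤ ·) l
  rw [← hp.length_eq]
  exact length_le_of_alternating_ne_zero (List.pairwise_insertionSort _ l)
    (fun a ha b hb => hc a (hp.mem_iff.1 ha) b (hp.mem_iff.1 hb)) h

end Labels
-- Sign vectors, flags and the octahedral Tucker lemma
section SignVectors

variable {V : Type*}

/-- The order on sign vectors: `x` arises from `y` by replacing some entries by zero. -/
def SignLE (x y : V → SignType) : Prop := ∀ i, x i ≠ 0 → x i = y i

theorem SignLE.refl (x : V → SignType) : SignLE x x := fun _ _ => rfl

theorem SignLE.trans {x y z : V → SignType} (h : SignLE x y) (h' : SignLE y z) : SignLE x z :=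
  fun i hi => (h i hi).trans (h' i (h i hi ▸ hi))

/-- Decreasing lists of nonzero sign vectors below `x`. -/
def IsFlag (x : V → SignType) (l : List (V → SignType)) : Prop :=
  (∀ y ∈ l, y ≠ 0 ∧ SignLE y x) ∧ l.Pairwise fun y z => SignLE z y

theorem signLE_update_zero [DecidableEq V] (x : V → SignType) (i : V) : SignLE (Function.update x i 0) x := by
  intro j hj
  by_cases h : j = i
  · subst h; simp at hj
  · simp [h]

variable [Fintype V]

/-- The support of a sign vector. -/
def signSupport (x : V → SignType) : Finset V := {i | x i ≠ 0}

theorem mem_signSupport {x : V → SignType} {i : V} : i ∈ signSupport x ↔ x i ≠ 0 := by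
  simp [signSupport]

theorem signSupport_neg (x : V → SignType) : signSupport (-x) = signSupport x := by
  ext i
  simp [mem_signSupport]

theorem ne_zero_of_card_signSupport {x : V → SignType} {n : ℕ}
    (h : (signSupport x).card = n + 1) : x ≠ 0 := by
  rintro rfl
  simp [signSupport] at h

theorem SignLE.signSupport_subset {x y : V → SignType} (h : SignLE x y) :
    signSupport x ⊆ signSupport y := fun i hi => by
  rw [mem_signSupport] at *
  rwa [← h i hi]

theorem SignLE.eq_of_card {x y : V → SignType} (h : SignLE x y)
    (hc : (signSupport x).card = (signSupport y).card) : x = y := by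
  have hs := Finset.eq_of_subset_of_card_le h.signSupport_subset hc.ge
  funext i
  by_cases hi : x i = 0
  · have : i ∉ signSupport y := by rw [← hs, mem_signSupport]; simpa using hi
    rw [mem_signSupport, not_not] at this
    rw [hi, this]
  · exact h i hi

variable [DecidableEq V]

theorem signSupport_update_zero (x : V → SignType) (i : V) :
    signSupport (Function.update x i 0) = (signSupport x).erase i := by
  ext j
  by_cases h : j = i
  · subst h; simp [mem_signSupport]
  · simp [mem_signSupport, h]

theorem signSupport_update (x : V → SignType) (i : V) {s : SignType} (hs : s ≠ 0) :
    signSupport (Function.update x i s) = insert i (signSupport x) := by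
  ext j
  by_cases h : j = i
  · subst h; simp [mem_signSupport, hs]
  · simp [mem_signSupport, h]

theorem card_signSupport_update_zero {x : V → SignType} {n : ℕ}
    (h : (signSupport x).card = n + 1) {i : V} (hi : i ∈ signSupport x) :
    (signSupport (Function.update x i 0)).card = n := by
  rw [signSupport_update_zero, Finset.card_erase_of_mem hi, h, Nat.add_sub_cancel]

/-- The value of a cochain on the barycentric subdivision of the face of the cross-polytope given
by a sign vector `x` with support of size `n`. -/
def flagSum : ℕ → (List (V → SignType) → ZMod 2) → (V → SignType) → ZMod 2
  | 0, f, _ => f []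
  | n + 1, f, x => ∑ i ∈ signSupport x, flagSum n (fun l => f (x :: l)) (Function.update x i 0)

theorem flagSum_add (n : ℕ) (f g : List (V → SignType) → ZMod 2) (x : V → SignType) :
    flagSum n (fun l => f l + g l) x = flagSum n f x + flagSum n g x := by
  induction n generalizing f g x with
  | zero => rfl
  | succ n ih =>
    simp only [flagSum]
    rw [← Finset.sum_add_distrib]
    exact Finset.sum_congr rfl fun i _ => ih _ _ _

theorem flagSum_neg (n : ℕ) (f : List (V → SignType) → ZMod 2) (x : V → SignType) :
    flagSum n f (-x) = flagSum n (fun l => f (l.map Neg.neg)) x := by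
  induction n generalizing f x with
  | zero => rfl
  | succ n ih =>
    simp only [flagSum, signSupport_neg, List.map_cons]
    refine Finset.sum_congr rfl fun i _ => ?_
    rw [← ih (fun l => f (-x :: l)), ← neg_zero, Function.update_neg, neg_zero]

theorem flagSum_congr {n : ℕ} {f g : List (V → SignType) → ZMod 2} {x : V → SignType}
    (hx : (signSupport x).card = n) (h : ∀ l, l.length = n → IsFlag x l → f l = g l) :
    flagSum n f x = flagSum n g x := by
  induction n generalizing f g x with
  | zero => exact h [] rfl ⟨by simp, List.Pairwise.nil⟩
  | succ n ih =>
    refine Finset.sum_congr rfl fun i hi => ih (card_signSupport_update_zero hx hi) ?_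
    intro l hl hf
    have hle : ∀ y ∈ l, SignLE y x := fun y hy => (hf.1 y hy).2.trans (signLE_update_zero x i)
    refine h _ (by simp [hl]) ⟨?_, List.pairwise_cons.2 ⟨hle, hf.2⟩⟩
    intro y hy
    rcases List.mem_cons.1 hy with rfl | hy
    · exact ⟨ne_zero_of_card_signSupport hx, SignLE.refl _⟩
    · exact ⟨(hf.1 y hy).1, hle y hy⟩

/-- Each face of codimension two is reached twice, by deleting its two missing coordinates in either
order. -/
theorem sum_sum_update_eq_zero (x : V → SignType) (G : (V → SignType) → ZMod 2) :
    ∑ i ∈ signSupport x, ∑ j ∈ signSupport (Function.update x i 0),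
      G (Function.update (Function.update x i 0) j 0) = 0 := by
  rw [Finset.sum_sigma']
  refine Finset.sum_involution (fun p _ => ⟨p.2, p.1⟩) ?_ ?_ ?_ ?_
  · rintro ⟨i, j⟩ h
    simp only [Finset.mem_sigma, signSupport_update_zero, Finset.mem_erase] at h
    simp only [Function.update_comm h.2.1]
    exact CharTwo.add_self_eq_zero _
  · rintro ⟨i, j⟩ h - he
    simp only [Finset.mem_sigma, signSupport_update_zero, Finset.mem_erase] at h
    exact h.2.1 (congrArg Sigma.fst he)
  · rintro ⟨i, j⟩ h
    simp only [Finset.mem_sigma, signSupport_update_zero, Finset.mem_erase] at h ⊢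
    exact ⟨h.2.2, h.2.1.symm, h.1⟩
  · rintro ⟨i, j⟩ h
    rfl

/-- Stokes' formula: omitting the top `x` of a flag leaves a full flag of a facet, while the other
omissions cancel in pairs. -/
theorem flagSum_coboundary {n : ℕ} (f : List (V → SignType) → ZMod 2) {x : V → SignType}
    (hx : (signSupport x).card = n + 1) :
    flagSum (n + 1) (coboundary f) x =
      ∑ i ∈ signSupport x, flagSum n f (Function.update x i 0) := by
  induction n generalizing f x with
  | zero => simp [flagSum, coboundary]
  | succ n ih =>
    rw [flagSum]
    simp only [coboundary, flagSum_add]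
    rw [Finset.sum_add_distrib, Finset.sum_congr rfl fun i hi =>
      ih (fun l => f (x :: l)) (card_signSupport_update_zero hx hi),
      sum_sum_update_eq_zero x fun y => flagSum n (fun l => f (x :: l)) y, add_zero]

/-- The boundary of a hemisphere is the equator: a facet missing `i ∈ A` lies in two cells,
differing in the sign at `i`, and cancels; deleting `a` gives each equatorial cell once. -/
theorem sum_update_sphere {A : Finset V} {a : V} (ha : a ∉ A) (G : (V → SignType) → ZMod 2) :
    ∑ x : V → SignType with signSupport x = insert a A ∧ x a = 1,
      ∑ i ∈ insert a A, G (Function.update x i 0) =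
      ∑ x : V → SignType with signSupport x = A, G x := by
  rw [Finset.sum_comm, Finset.sum_insert ha]
  have h0 : ∀ i ∈ A, ∑ x : V → SignType with signSupport x = insert a A ∧ x a = 1,
      G (Function.update x i 0) = 0 := by
    intro i hi
    have hia : a ≠ i := fun h => ha (h ▸ hi)
    refine Finset.sum_involution (fun x _ => Function.update x i (-x i)) ?_ ?_ ?_ ?_
    · intro x _
      simp only [Function.update_idem]
      exact CharTwo.add_self_eq_zero _
    · intro x hx _ he
      have hxi : x i ≠ 0 := by
        rw [← mem_signSupport, (Finset.mem_filter.1 hx).2.1]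
        exact Finset.mem_insert_of_mem hi
      have := congrFun he i
      rw [Function.update_self] at this
      revert this hxi
      cases x i <;> decide
    · intro x hx
      obtain ⟨-, hx, hxa⟩ := Finset.mem_filter.1 hx
      have hxi : i ∈ signSupport x := hx ▸ Finset.mem_insert_of_mem hi
      have hxi' : -x i ≠ 0 := by
        rw [mem_signSupport] at hxi
        revert hxi
        cases x i <;> decide
      refine Finset.mem_filter.2 ⟨Finset.mem_univ _, ?_, ?_⟩
      · rw [signSupport_update _ _ hxi', Finset.insert_eq_of_mem hxi, hx]
      · rw [Function.update_of_ne hia, hxa]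
    · intro x _
      simp
  rw [Finset.sum_eq_zero h0, add_zero]
  refine Finset.sum_bij' (fun x _ => Function.update x a 0) (fun x _ => Function.update x a 1)
    ?_ ?_ ?_ ?_ ?_
  · intro x hx
    obtain ⟨-, hx, hxa⟩ := Finset.mem_filter.1 hx
    simp [signSupport_update_zero, hx, ha]
  · intro x hx
    obtain ⟨-, hx⟩ := Finset.mem_filter.1 hx
    refine Finset.mem_filter.2 ⟨Finset.mem_univ _, ?_, by simp⟩
    rw [signSupport_update _ _ (by decide), hx]
  · intro x hx
    obtain ⟨-, hx, hxa⟩ := Finset.mem_filter.1 hx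
    simp [← hxa]
  · intro x hx
    obtain ⟨-, hx⟩ := Finset.mem_filter.1 hx
    have hxa : x a = 0 := by
      by_contra h
      exact ha (hx ▸ mem_signSupport.2 h)
    simp [← hxa]
  · intro x _
    rfl

theorem sum_sphere_eq_sum_hemisphere {A : Finset V} {a : V} (G : (V → SignType) → ZMod 2) :
    ∑ x : V → SignType with signSupport x = insert a A, G x =
      ∑ x : V → SignType with signSupport x = insert a A ∧ x a = 1, (G x + G (-x)) := by
  rw [Finset.sum_add_distrib, ← Finset.sum_filter_add_sum_filter_not _ (fun x => x a = 1),
    Finset.filter_filter, Finset.filter_filter]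
  congr 1
  refine Finset.sum_bij' (fun x _ => -x) (fun x _ => -x) ?_ ?_ ?_ ?_ ?_
  · intro x hx
    obtain ⟨-, hx, hxa⟩ := Finset.mem_filter.1 hx
    refine Finset.mem_filter.2 ⟨Finset.mem_univ _, by rw [signSupport_neg, hx], ?_⟩
    have : x a ≠ 0 := mem_signSupport.1 (hx ▸ Finset.mem_insert_self a A)
    rw [Pi.neg_apply]
    revert this hxa
    cases x a <;> decide
  · intro x hx
    obtain ⟨-, hx, hxa⟩ := Finset.mem_filter.1 hx
    refine Finset.mem_filter.2 ⟨Finset.mem_univ _, by rw [signSupport_neg, hx], ?_⟩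
    rw [Pi.neg_apply, hxa]
    decide
  · intro x _
    exact neg_neg x
  · intro x _
    exact neg_neg x
  · intro x _
    simp only [neg_neg]

theorem sum_flagSum_eq_one {F : List (V → SignType) → ZMod 2} (h0 : F [] = 1)
    (hF : ∀ x l, IsFlag x l → coboundary F l = F l + F (l.map Neg.neg)) (A : Finset V) :
    ∑ x : V → SignType with signSupport x = A, flagSum A.card F x = 1 := by
  induction A using Finset.induction with
  | empty =>
    have : ({x : V → SignType | signSupport x = ∅} : Finset _) = {0} := by
      ext x
      simp [signSupport, Finset.filter_eq_empty_iff, funext_iff]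
    rw [this]
    simpa [flagSum] using h0
  | insert a A ha ih =>
    rw [sum_sphere_eq_sum_hemisphere, ← ih, ← sum_update_sphere ha]
    refine Finset.sum_congr rfl fun x hx => ?_
    obtain ⟨-, hx, -⟩ := Finset.mem_filter.1 hx
    have hc := Finset.card_insert_of_notMem ha
    rw [hc]
    rw [← hx] at hc
    rw [flagSum_neg, ← flagSum_add, ← hx, ← flagSum_coboundary F hc]
    exact flagSum_congr hc fun l _ hl => (hF x l hl).symm

end SignVectors

/-- The octahedral Tucker lemma. -/
theorem octahedral_tucker {V ι : Type*} [Fintype V] [Fintype ι] [LinearOrder ι]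
    (lam : (V → SignType) → ι ×ₗ Bool) (hneg : ∀ x, x ≠ 0 → lam (-x) = flipSign (lam x))
    (hc : ∀ x y, x ≠ 0 → y ≠ 0 → SignLE x y → lam x ≠ flipSign (lam y)) :
    Fintype.card V ≤ Fintype.card ι := by
  classical
  have hflag : ∀ x l, IsFlag x l → ∀ a ∈ l.map lam, ∀ b ∈ l.map lam, b ≠ flipSign a := by
    intro x l hl
    have hsymm : ∀ a b : ι ×ₗ Bool, b = flipSign a → a = flipSign b := by
      rintro a _ rfl
      simp [flipSign]
    have hp : l.Pairwise fun y z => lam z ≠ flipSign (lam y) :=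
      hl.2.imp_of_mem fun hy hz h => hc _ _ (hl.1 _ hz).1 (hl.1 _ hy).1 h
    simp only [List.mem_map]
    rintro _ ⟨y, hy, rfl⟩ _ ⟨z, hz, rfl⟩
    by_cases hyz : y = z
    · subst hyz
      exact hc _ _ (hl.1 _ hy).1 (hl.1 _ hy).1 (SignLE.refl _)
    · have : Std.Symm fun y z => lam z ≠ flipSign (lam y) := ⟨fun _ _ h h' => h (hsymm _ _ h')⟩
      exact hp.forall hy hz hyz
  have hsum := sum_flagSum_eq_one (V := V) (F := fun l => fanCochain (l.map lam)) rfl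
    (fun x l hl => by
      rw [coboundary_map, coboundary_fanCochain (hflag x l hl), List.map_map, List.map_map]
      congr 2
      exact List.map_congr_left fun y hy => (hneg y (hl.1 y hy).1).symm) Finset.univ
  obtain ⟨x, hx, hne⟩ := Finset.exists_ne_zero_of_sum_ne_zero (hsum.trans_ne one_ne_zero)
  obtain ⟨-, hx⟩ := Finset.mem_filter.1 hx
  by_contra hlt
  -- If there are fewer indices than vertices, Fan's cochain vanishes on every full flag.
  refine hne ((flagSum_congr (g := fun _ => 0) (by rw [hx]) ?_).trans ?_)
  · intro l hl hfl
    by_contra h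
    have := length_le_of_fanCochain_ne_zero (hflag x l hfl) h
    rw [List.length_map, hl] at this
    exact hlt this
  · have := flagSum_add (Finset.univ : Finset V).card (fun _ => 0) (fun _ => 0) x
    simpa using this
-- Dol'nikov's theorem
namespace Hypergraph

variable {α : Type*}

/-- The vertices of `H` at which the sign vector `x` takes the value `s`. -/
def signPart (H : Hypergraph α) (x : H.vertexSet → SignType) (s : SignType) : Set α :=
  {v | ∃ h : v ∈ H.vertexSet, x ⟨v, h⟩ = s}

theorem signPart_neg (H : Hypergraph α) (x : H.vertexSet → SignType) (s : SignType) :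
    H.signPart (-x) s = H.signPart x (-s) := by
  ext v
  simp only [signPart, Set.mem_ofPred_eq, Pi.neg_apply, neg_eq_iff_eq_neg]

theorem signPart_mono {H : Hypergraph α} {x y : H.vertexSet → SignType} (h : SignLE x y)
    {s : SignType} (hs : s ≠ 0) : H.signPart x s ⊆ H.signPart y s := by
  rintro v ⟨hv, rfl⟩
  exact ⟨hv, (h _ hs).symm⟩

theorem disjoint_signPart (H : Hypergraph α) (x : H.vertexSet → SignType) {s s' : SignType}
    (h : s ≠ s') : Disjoint (H.signPart x s) (H.signPart x s') :=
  Set.disjoint_left.2 fun _ ⟨_, h₁⟩ ⟨_, h₂⟩ => h (h₁.symm.trans h₂)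

/-- A sign vector without edges in its positive and negative parts gives a 2-coloring of the
hypergraph that remains after removing its zeros. -/
theorem isTwoColorable_removeVertices_signPart {H : Hypergraph α} (x : H.vertexSet → SignType)
    (hx : ∀ e ∈ H.edgeSet, ¬ e ⊆ H.signPart x 1 ∧ ¬ e ⊆ H.signPart x (-1)) :
    (H.removeVertices (H.signPart x 0)).IsTwoColorable := by
  classical
  refine ⟨fun v => if x ⟨v.1, v.2.1⟩ = 1 then 0 else 1, ?_⟩
  rintro e ⟨he, heU⟩ ⟨a, ha⟩
  have hV : ∀ v ∈ e, ∃ h : v ∈ H.vertexSet,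
      x ⟨v, h⟩ ≠ 0 ∧ (if x ⟨v, h⟩ = 1 then (0 : Fin 2) else 1) = a := by
    intro v hv
    have hvV := H.subset_vertexSet_of_mem_edgeSet' he hv
    have hvU : v ∉ H.signPart x 0 := fun h => Set.notMem_empty v (heU ▸ ⟨hv, h⟩)
    exact ⟨hvV, fun h => hvU ⟨hvV, h⟩, ha ⟨v, hvV, hvU⟩ hv⟩
  fin_cases a
  · refine (hx e he).1 fun v hv => ?_
    obtain ⟨h, -, h2⟩ := hV v hv
    refine ⟨h, ?_⟩
    by_contra h3
    simp [h3] at h2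
  · refine (hx e he).2 fun v hv => ?_
    obtain ⟨h, h1, h2⟩ := hV v hv
    refine ⟨h, ?_⟩
    have h3 : x ⟨v, h⟩ ≠ 1 := fun h3 => by simp [h3] at h2
    revert h1 h3
    cases x ⟨v, h⟩ <;> decide

theorem encard_signPart_zero (H : Hypergraph α) [Fintype H.vertexSet]
    (x : H.vertexSet → SignType) :
    (H.signPart x 0).encard + (signSupport x).card = Fintype.card H.vertexSet := by
  classical
  have h : H.signPart x 0 = Subtype.val '' (((signSupport x)ᶜ : Finset H.vertexSet) : Set H.vertexSet) := by
    ext v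
    simp only [signPart, Set.mem_ofPred_eq, Set.mem_image, Finset.mem_coe, Finset.mem_compl,
      mem_signSupport, not_not]
    constructor
    · rintro ⟨h, h'⟩
      exact ⟨⟨v, h⟩, h', rfl⟩
    · rintro ⟨⟨w, h⟩, h', rfl⟩
      exact ⟨h, h'⟩
  rw [h, Subtype.val_injective.encard_image, Set.encard_coe_eq_coe_finsetCard]
  norm_cast
  rw [add_comm, Finset.card_add_card_compl]

theorem colorabilityDefect_le_encard {H : Hypergraph α} {U : Set α} (hU : U ⊆ H.vertexSet)
    (h : (H.removeVertices U).IsTwoColorable) : H.colorabilityDefect ≤ U.encard :=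
  sInf_le ⟨U, hU, h, rfl⟩

/-- Removing the zeros of `x` leaves a 2-colorable hypergraph, so there are more than `t` zeros. -/
theorem card_signSupport_lt {H : Hypergraph α} [Fintype H.vertexSet] {t : ℕ}
    (ht : (t : ℕ∞) < H.colorabilityDefect) (x : H.vertexSet → SignType)
    (hx : ∀ e ∈ H.edgeSet, ¬ e ⊆ H.signPart x 1 ∧ ¬ e ⊆ H.signPart x (-1)) :
    (signSupport x).card + t < Fintype.card H.vertexSet := by
  have h := ht.trans_le (colorabilityDefect_le_encard (fun _ hv => hv.1)
    (isTwoColorable_removeVertices_signPart x hx))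
  have h' := H.encard_signPart_zero x
  have hne : (H.signPart x 0).encard ≠ ⊤ := fun h => by
    rw [h, top_add] at h'
    exact ENat.top_ne_natCast _ h'
  lift (H.signPart x 0).encard to ℕ using hne with u
  norm_cast at h h'
  omega

/-- The colors of the edges contained in the positive or negative part of a sign vector. -/
def signColors (H : Hypergraph α) {t : ℕ} (c : H.kneserGraph.Coloring (Fin t))
    (x : H.vertexSet → SignType) (s : SignType) : Set (Fin t) :=
  {i | ∃ e : H.edgeSet, e.1 ⊆ H.signPart x s ∧ c e = i}

theorem notMem_signColors {H : Hypergraph α} (hne : ∀ e ∈ H.edgeSet, e.Nonempty) {t : ℕ}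
    (c : H.kneserGraph.Coloring (Fin t)) {x : H.vertexSet → SignType} {s s' : SignType}
    (hs : s ≠ s') {i : Fin t} (hi : i ∈ H.signColors c x s) : i ∉ H.signColors c x s' := by
  obtain ⟨e, he, rfl⟩ := hi
  rintro ⟨f, hf, hfe⟩
  have hd : Disjoint e.1 f.1 := (H.disjoint_signPart x hs).mono he hf
  refine c.valid (v := e) (w := f) ⟨?_, hd⟩ hfe.symm
  rintro rfl
  exact (hne _ e.2).ne_empty (disjoint_self.1 hd)

/-- Dol'nikov's theorem: the 2-colorability defect of a hypergraph is a lower bound for the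
chromatic number of its Kneser graph. -/
theorem colorabilityDefect_le_chromaticNumber (H : Hypergraph α) (hfin : H.vertexSet.Finite)
    (hne : ∀ e ∈ H.edgeSet, e.Nonempty) :
    H.colorabilityDefect ≤ H.kneserGraph.chromaticNumber := by
  classical
  by_contra! hlt
  obtain ⟨t, ht⟩ := ENat.ne_top_iff_exists.1 hlt.ne_top
  rw [← ht] at hlt
  obtain ⟨c⟩ : H.kneserGraph.Colorable t :=
    SimpleGraph.chromaticNumber_le_iff_colorable.1 ht.ge
  have := hfin.fintype
  have hN : t < Fintype.card H.vertexSet := by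
    refine (Nat.le_add_left _ _).trans_lt (card_signSupport_lt hlt 0 fun e he => ⟨?_, ?_⟩) <;>
    · intro h
      obtain ⟨v, hv⟩ := hne e he
      obtain ⟨_, h'⟩ := h hv
      rw [Pi.zero_apply] at h'
      revert h'
      decide
  -- `hN` makes this subtraction exact, so `a + t` is one less than the number of vertices.
  let a := Fintype.card H.vertexSet - t - 1
  let C : (H.vertexSet → SignType) → Set (Fin t) :=
    fun x => H.signColors c x 1 ∪ H.signColors c x (-1)
  have hCneg : ∀ x s, H.signColors c (-x) s = H.signColors c x (-s) := fun x s => by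
    simp only [signColors, signPart_neg]
  have hC : ∀ x, C (-x) = C x := fun x => by
    simp only [C, hCneg, neg_neg, Set.union_comm]
  have hsmall : ∀ x, ¬ (C x).Nonempty → (signSupport x).card ≤ a := by
    intro x hx
    rw [Set.not_nonempty_iff_eq_empty] at hx
    have := card_signSupport_lt hlt x fun e he =>
      ⟨fun h => Set.notMem_empty (c ⟨e, he⟩) (hx ▸ Or.inl ⟨⟨e, he⟩, h, rfl⟩),
        fun h => Set.notMem_empty (c ⟨e, he⟩) (hx ▸ Or.inr ⟨⟨e, he⟩, h, rfl⟩)⟩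
    omega
  have : Nonempty (Fin a ⊕ₗ Fin t) := by
    by_cases h : (C 1).Nonempty
    · exact ⟨toLex (Sum.inr h.some)⟩
    · have h1 := hsmall 1 h
      have h2 : signSupport (1 : H.vertexSet → SignType) = Finset.univ :=
        Finset.filter_true_of_mem fun i _ => by
          rw [Pi.one_apply]
          decide
      rw [h2, Finset.card_univ] at h1
      exact ⟨toLex (Sum.inl ⟨0, by omega⟩)⟩
  -- The label is a color seen by `x`, signed by the part containing it, or, if there is none, the
  -- support size shifted to start at 0, signed by a chosen entry. Choices depend only on `C x` or
  -- the support, both invariant under negation. The arbitrary value is never used for `x ≠ 0`.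
  let idx : Set (Fin t) → ℕ → Fin a ⊕ₗ Fin t := fun S n =>
    if h : S.Nonempty then toLex (Sum.inr h.some)
    else if h' : n - 1 < a then toLex (Sum.inl ⟨n - 1, h'⟩) else Classical.arbitrary _
  let sgn : Set (Fin t) → Set (Fin t) → Finset H.vertexSet → (H.vertexSet → SignType) → Bool :=
    fun S P T x => if h : S.Nonempty then decide (h.some ∈ P)
      else if h' : T.Nonempty then decide (x h'.choose = 1) else true
  let lam : (H.vertexSet → SignType) → (Fin a ⊕ₗ Fin t) ×ₗ Bool := fun x =>
    toLex (idx (C x) (signSupport x).card, sgn (C x) (H.signColors c x 1) (signSupport x) x)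
  have hlarge : ∀ x, (C x).Nonempty → ∃ i ∈ C x,
      lam x = toLex (toLex (Sum.inr i), decide (i ∈ H.signColors c x 1)) ∧
      lam (-x) = toLex (toLex (Sum.inr i), decide (i ∈ H.signColors c x (-1))) := by
    intro x h
    refine ⟨h.some, h.some_mem, ?_, ?_⟩ <;> simp only [lam, hC, idx, sgn, dif_pos h, hCneg]
  have hzero : ∀ x, x ≠ 0 → ¬ (C x).Nonempty → ∃ v ∈ signSupport x,
      ∃ h : (signSupport x).card - 1 < a,
      lam x = toLex (toLex (Sum.inl ⟨(signSupport x).card - 1, h⟩), decide (x v = 1)) ∧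
      lam (-x) = toLex (toLex (Sum.inl ⟨(signSupport x).card - 1, h⟩), decide (-x v = 1)) := by
    intro x hx h
    have hS : (signSupport x).Nonempty := by
      obtain ⟨i, hi⟩ := Function.ne_iff.1 hx
      exact ⟨i, mem_signSupport.2 hi⟩
    have ha : (signSupport x).card - 1 < a := by
      have := hS.card_pos
      have := hsmall x h
      omega
    refine ⟨hS.choose, hS.choose_spec, ha, ?_, ?_⟩ <;>
    simp only [lam, hC, idx, sgn, dif_neg h, signSupport_neg, dif_pos ha, dif_pos hS, Pi.neg_apply]
  have hexcl : ∀ x, ∀ i ∈ H.signColors c x 1, i ∉ H.signColors c x (-1) :=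
    fun x i hi => notMem_signColors hne c (by decide) hi
  have key := octahedral_tucker lam ?_ ?_
  · rw [Fintype.card_lex, Fintype.card_sum, Fintype.card_fin, Fintype.card_fin] at key
    omega
  · intro x hx
    by_cases h : (C x).Nonempty
    · obtain ⟨i, hi, h1, h2⟩ := hlarge x h
      have : i ∈ H.signColors c x (-1) ↔ i ∉ H.signColors c x 1 :=
        ⟨fun h h' => hexcl x i h' h, fun h => hi.resolve_left h⟩
      rw [h1, h2]
      simp [flipSign, this]
    · obtain ⟨v, hv, ha, h1, h2⟩ := hzero x hx h
      rw [h1, h2]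
      rw [mem_signSupport] at hv
      have : decide (-x v = 1) = !decide (x v = 1) := by
        revert hv
        generalize x v = s
        cases s <;> decide
      simp only [flipSign, ofLex_toLex, this]
  · intro x y hx hy hxy heq
    have hmono : ∀ s, s ≠ 0 → H.signColors c x s ⊆ H.signColors c y s := by
      rintro s hs _ ⟨e, he, rfl⟩
      exact ⟨e, he.trans (signPart_mono hxy hs), rfl⟩
    by_cases h : (C x).Nonempty
    · obtain ⟨i, hi, h1, -⟩ := hlarge x h
      have h' : (C y).Nonempty := h.mono
        (Set.union_subset_union (hmono 1 (by decide)) (hmono (-1) (by decide)))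
      obtain ⟨j, hj, h3, -⟩ := hlarge y h'
      rw [h1, h3] at heq
      simp only [flipSign, ofLex_toLex, EmbeddingLike.apply_eq_iff_eq, Prod.mk.injEq,
        Sum.inr.injEq] at heq
      obtain ⟨rfl, heq⟩ := heq
      rcases hi with hi | hi
      · have := hmono 1 (by decide) hi
        simp [hi, this] at heq
      · have hi' : i ∉ H.signColors c x 1 := fun h => hexcl x i h hi
        have hy' : i ∉ H.signColors c y 1 := fun h =>
          hexcl y i h (hmono (-1) (by decide) hi)
        simp [hi', hy'] at heq
    · obtain ⟨v, hv, ha, h1, -⟩ := hzero x hx h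
      by_cases h' : (C y).Nonempty
      · obtain ⟨j, hj, h3, -⟩ := hlarge y h'
        rw [h1, h3] at heq
        simp [flipSign] at heq
      · have hcard : (signSupport x).card = (signSupport y).card := by
          obtain ⟨w, hw, hb, h3, -⟩ := hzero y hy h'
          rw [h1, h3] at heq
          simp only [flipSign, ofLex_toLex, EmbeddingLike.apply_eq_iff_eq, Prod.mk.injEq,
            Sum.inl.injEq, Fin.mk.injEq] at heq
          have := Finset.card_pos.2 ⟨v, hv⟩
          have := Finset.card_pos.2 ⟨w, hw⟩
          omega
        obtain rfl := hxy.eq_of_card hcard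
        -- Equal support sizes forced `x = y`, and no sign equals its own flip.
        have := congrArg (fun p => (ofLex p).2) heq
        simp [flipSign] at this

end Hypergraph

/-! ### Defect and coloring of the hypergraph `hypergraphH n m k` -/

theorem nonempty_of_mem_setSystemF {n m k : ℕ} (hk : 1 ≤ k) {e : Set ℕ}
    (he : e ∈ setSystemF n m k) : e.Nonempty := by
  have h0 : e.encard = k → e.Nonempty := fun h => by
    rw [← Set.encard_ne_zero, h]
    exact_mod_cast Nat.one_le_iff_ne_zero.1 hk
  rcases he with (⟨-, h⟩ | ⟨i, -, j, -, rfl⟩) | ⟨-, h⟩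
  · exact h0 h
  · exact Set.insert_nonempty _ _
  · exact h0 h

/-- What remains is `[2k-2]`, split into two blocks of `k - 1` elements; no cross pair survives
because `n ≥ 2k - 1`. -/
theorem isTwoColorable_hypergraphH_removeVertices {n m k : ℕ} (hk : 1 ≤ k)
    (hn : 2 * k - 1 ≤ n) :
    ((hypergraphH n m k).removeVertices (Set.Icc (2 * k - 1) (n + m))).IsTwoColorable := by
  classical
  refine ⟨fun v => if v.1 < k then 0 else 1, ?_⟩
  rintro e ⟨he, heU⟩ ⟨a, ha⟩
  have hsub : ∀ v ∈ e, 1 ≤ v ∧ v < 2 * k - 1 ∧ (if v < k then (0 : Fin 2) else 1) = a := by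
    intro v hv
    have hvV : v ∈ Set.Icc 1 (n + m) := (hypergraphH n m k).subset_vertexSet_of_mem_edgeSet' he hv
    have hvU : v ∉ Set.Icc (2 * k - 1) (n + m) := fun h => Set.notMem_empty v (heU ▸ ⟨hv, h⟩)
    refine ⟨hvV.1, ?_, ha ⟨v, hvV, hvU⟩ hv⟩
    by_contra h
    exact hvU ⟨not_lt.1 h, hvV.2⟩
  have hcard : e.encard ≠ k := by
    intro h
    obtain ⟨l, hl⟩ : ∃ l, e ⊆ Finset.Ico l (l + (k - 1)) := by
      fin_cases a
      · refine ⟨1, fun v hv => ?_⟩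
        obtain ⟨h1, h2, h3⟩ := hsub v hv
        have : v < k := by
          by_contra h
          simp [h] at h3
        simp only [Finset.coe_Ico, Set.mem_Ico]
        omega
      · refine ⟨k, fun v hv => ?_⟩
        obtain ⟨h1, h2, h3⟩ := hsub v hv
        have : ¬ v < k := by
          intro h
          simp [h] at h3
        simp only [Finset.coe_Ico, Set.mem_Ico]
        omega
    have := Set.encard_le_encard hl
    rw [h, Set.encard_coe_eq_coe_finsetCard, Nat.card_Ico] at this
    norm_cast at this
    omega
  rcases he with (⟨-, h⟩ | ⟨i, -, j, ⟨hj1, hj2⟩, rfl⟩) | ⟨-, h⟩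
  · exact hcard h
  · obtain ⟨h1, h2, -⟩ := hsub j (by simp)
    exact hj2 ⟨h1, by omega⟩
  · exact hcard h

theorem le_encard_of_isTwoColorable_removeVertices {n m k : ℕ} (hk : 1 ≤ k) {U : Set ℕ}
    (hU : U ⊆ Set.Icc 1 (n + m)) (h : ((hypergraphH n m k).removeVertices U).IsTwoColorable) :
    ((n + m + 2 - 2 * k : ℕ) : ℕ∞) ≤ U.encard := by
  classical
  obtain ⟨c, hc⟩ := h
  have hUf : U.Finite := (Set.finite_Icc 1 (n + m)).subset hU
  lift U to Finset ℕ using hUf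
  let W : Finset ℕ := Finset.Icc 1 (n + m) \ U
  have hW : ∀ v, v ∈ W ↔ v ∈ ((hypergraphH n m k).removeVertices U).vertexSet := by
    intro v
    simp [W, Hypergraph.removeVertices, hypergraphH]
  let A : Fin 2 → Finset ℕ := fun a => {v ∈ W | v ≤ n ∧ ∃ h, c ⟨v, h⟩ = a}
  let B : Fin 2 → Finset ℕ := fun a => {v ∈ W | n < v ∧ ∃ h, c ⟨v, h⟩ = a}
  have hdisj : ∀ e : Set ℕ, e ⊆ W → e ∩ U = ∅ := by
    intro e he
    ext v
    simp only [Set.mem_inter_iff, Set.mem_empty_iff_false, iff_false, not_and]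
    intro hv hvU
    exact (Finset.mem_sdiff.1 (he hv)).2 hvU
  have hmono : ∀ e ∈ setSystemF n m k, e ⊆ W → ∀ a, ¬ ∀ v ∈ e, ∃ h, c ⟨v, h⟩ = a := by
    intro e he heW a h
    exact hc e ⟨he, hdisj e heW⟩ ⟨a, fun v hv => (h v hv).2⟩
  have hA : ∀ a, (A a).card ≤ k - 1 := by
    intro a
    by_contra! hlt
    obtain ⟨e, he, hcard⟩ := Finset.exists_subset_card_eq (show k ≤ (A a).card by omega)
    have he' := fun v (hv : v ∈ e) => Finset.mem_filter.1 (he hv)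
    refine hmono e (Or.inl (Or.inl ⟨?_, by simp [hcard]⟩)) (fun v hv => (he' v hv).1) a
      fun v hv => (he' v hv).2.2
    intro v hv
    have := (Finset.mem_sdiff.1 (he' v hv).1).1
    exact ⟨(Finset.mem_Icc.1 this).1, (he' v hv).2.1⟩
  have hB : ∀ a, (B a).card ≤ k - 1 := by
    intro a
    by_contra! hlt
    obtain ⟨e, he, hcard⟩ := Finset.exists_subset_card_eq (show k ≤ (B a).card by omega)
    have he' := fun v (hv : v ∈ e) => Finset.mem_filter.1 (he hv)
    refine hmono e (Or.inr ⟨?_, by simp [hcard]⟩) (fun v hv => (he' v hv).1) a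
      fun v hv => (he' v hv).2.2
    intro v hv
    have := (Finset.mem_sdiff.1 (he' v hv).1).1
    exact ⟨Finset.mem_Icc.1 this, fun h => (he' v hv).2.1.not_ge h.2⟩
  -- A color class meeting both sides of `n` would contain a monochromatic cross pair.
  have hAB : ∀ a, (A a).card + (B a).card ≤ k - 1 := by
    intro a
    rcases (A a).eq_empty_or_nonempty with h | ⟨i, hi⟩
    · simpa [h] using hB a
    rcases (B a).eq_empty_or_nonempty with h | ⟨j, hj⟩
    · simpa [h] using hA a
    exfalso
    obtain ⟨hi1, hi2, hi3⟩ := Finset.mem_filter.1 hi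
    obtain ⟨hj1, hj2, hj3⟩ := Finset.mem_filter.1 hj
    have hi4 := Finset.mem_Icc.1 (Finset.mem_sdiff.1 hi1).1
    have hj4 := Finset.mem_Icc.1 (Finset.mem_sdiff.1 hj1).1
    refine hmono {i, j} (Or.inl (Or.inr ⟨i, ⟨hi4.1, hi2⟩, j, ⟨hj4, fun h => hj2.not_ge h.2⟩, rfl⟩))
      ?_ a ?_
    · rintro v (rfl | rfl)
      · exact hi1
      · exact hj1
    · rintro v (rfl | rfl)
      · exact hi3
      · exact hj3
  have hcover : W ⊆ (A 0 ∪ B 0) ∪ (A 1 ∪ B 1) := by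
    intro v hv
    have hv' := (hW v).1 hv
    simp only [Finset.mem_union, A, B, Finset.mem_filter, hv, true_and]
    have : c ⟨v, hv'⟩ = 0 ∨ c ⟨v, hv'⟩ = 1 := by
      generalize c ⟨v, hv'⟩ = b
      fin_cases b <;> simp
    rcases this with h | h <;> rcases le_or_gt v n with h' | h'
    · exact Or.inl (Or.inl ⟨h', hv', h⟩)
    · exact Or.inl (Or.inr ⟨h', hv', h⟩)
    · exact Or.inr (Or.inl ⟨h', hv', h⟩)
    · exact Or.inr (Or.inr ⟨h', hv', h⟩)
  have h1 := (Finset.card_le_card hcover).trans (Finset.card_union_le _ _)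
  have h2 := Finset.card_union_le (A 0) (B 0)
  have h3 := Finset.card_union_le (A 1) (B 1)
  have h4 := hAB 0
  have h5 := hAB 1
  have h6 : n + m - U.card ≤ W.card := by
    have := Finset.le_card_sdiff U (Finset.Icc 1 (n + m))
    rwa [Nat.card_Icc, Nat.add_sub_cancel] at this
  rw [Set.encard_coe_eq_coe_finsetCard]
  norm_cast
  omega

theorem colorabilityDefect_hypergraphH {n m k : ℕ} (hk : 1 ≤ k) (hn : 2 * k - 1 ≤ n) :
    (hypergraphH n m k).colorabilityDefect = ((n + m + 2 - 2 * k : ℕ) : ℕ∞) := by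
  refine le_antisymm ?_ (le_sInf ?_)
  · refine (Hypergraph.colorabilityDefect_le_encard (Set.Icc_subset_Icc_left (by omega))
      (isTwoColorable_hypergraphH_removeVertices hk hn)).trans ?_
    rw [← Finset.coe_Icc, Set.encard_coe_eq_coe_finsetCard, Nat.card_Icc]
    norm_cast
    omega
  · rintro _ ⟨U, hU, h, rfl⟩
    exact le_encard_of_isTwoColorable_removeVertices hk hU h

/-- Coloring the edges by their maximal elements, with all edges inside `[2k-1]` identified. -/
theorem colorable_kneserGraph_hypergraphH {n m k : ℕ} (hk : 1 ≤ k) (hn : 2 * k - 1 ≤ n) :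
    (hypergraphH n m k).kneserGraph.Colorable (n + m + 2 - 2 * k) := by
  have hsub : ∀ e ∈ setSystemF n m k, e ⊆ Set.Icc 1 (n + m) :=
    fun e he => (hypergraphH n m k).subset_vertexSet_of_mem_edgeSet' he
  have hbdd : ∀ e ∈ setSystemF n m k, BddAbove e :=
    fun e he => bddAbove_Icc.mono (hsub e he)
  have hmem : ∀ e ∈ setSystemF n m k, sSup e ∈ e :=
    fun e he => Nat.sSup_mem (nonempty_of_mem_setSystemF hk he) (hbdd e he)
  -- Truncated subtraction merges all maxima up to `2k - 1` into color 0. Edges with such maxima are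
  -- `k`-subsets of `[2k-1]`, so no two of them are disjoint.
  refine ⟨SimpleGraph.Coloring.mk (fun e => ⟨sSup e.1 - (2 * k - 1), ?_⟩) ?_⟩
  · have := (hsub _ e.2 (hmem _ e.2)).2
    omega
  · rintro ⟨e, he⟩ ⟨f, hf⟩ ⟨-, hd⟩ heq
    simp only [Fin.mk.injEq] at heq
    have hd' := Set.disjoint_left.1 hd
    have hne : sSup e ≠ sSup f := fun h => hd' (hmem e he) (h ▸ hmem f hf)
    have hsmall : ∀ e ∈ setSystemF n m k, sSup e ≤ 2 * k - 1 →
        e ⊆ Finset.Icc 1 (2 * k - 1) ∧ e.encard = k := by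
      intro e he hle
      have hle' : ∀ v ∈ e, v ≤ 2 * k - 1 := fun v hv => (le_csSup (hbdd e he) hv).trans hle
      refine ⟨fun v hv => Finset.mem_coe.2 (Finset.mem_Icc.2 ⟨(hsub e he hv).1, hle' v hv⟩), ?_⟩
      rcases he with (⟨-, h⟩ | ⟨i, -, j, hj, rfl⟩) | ⟨-, h⟩
      · exact h
      · exact absurd ⟨hj.1.1, (hle' j (by simp)).trans hn⟩ hj.2
      · exact h
    obtain ⟨he1, he2⟩ := hsmall e he (by omega)
    obtain ⟨hf1, hf2⟩ := hsmall f hf (by omega)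
    have := Set.encard_le_encard (Set.union_subset he1 hf1)
    rw [Set.encard_union_eq hd, he2, hf2, Set.encard_coe_eq_coe_finsetCard, Nat.card_Icc] at this
    norm_cast at this
    omega

theorem mainTheorem6 (n m k : ℕ) (hk : 1 ≤ k) (hn : 2 * k - 1 ≤ n) (hm : 1 ≤ m) :
    (hypergraphH n m k).kneserGraph.chromaticNumber = (hypergraphH n m k).colorabilityDefect ∧
      (hypergraphH n m k).colorabilityDefect = ((n + m + 2 - 2 * k : ℕ) : ℕ∞) := by
  have hdef := colorabilityDefect_hypergraphH (m := m) hk hn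
  refine ⟨le_antisymm ?_ ?_, hdef⟩
  · rw [hdef]
    exact (colorable_kneserGraph_hypergraphH hk hn).chromaticNumber_le
  · exact Hypergraph.colorabilityDefect_le_chromaticNumber _ (Set.finite_Icc 1 (n + m))
      fun _ he => nonempty_of_mem_setSystemF hk he
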